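/- Let $(u(n))_{n\ge 1}$ be a strictly increasing sequence of positive real numbers with $u(n)\to+\infty$ as $n\to\infty$. Then there exists an even $C^\infty$ function $\Delta:\mathbb R\to(0,+\infty)$ with the following properties. 1. $\displaystyle\int_{-\infty}^{+\infty}\Delta(t)\,dt<\infty$. 2. There is a strictly increasing sequence of positive integers $\tau_i\to+\infty$ such that for every $i$ $$\sup_{t\in\mathbb R}\frac{\Delta(t+\tau_i)}{\Delta(t)}\le u(\tau_i).$$ 3. Define recursively $g_0(t)=\dfrac{\Delta(t+1)}{\Delta(t)}$ and $g_{m+1}(t)=\dfrac{g_m'(t)}{\Delta(t)}$ for $m\ge 0$. Then $g_0(t)\to 1$ as $t\to+\infty$ and as $t\to-\infty$, and for every integer $m\ge 1$, $g_m(t)\to 0$ as $t\to+\infty$ and as $t\to-\infty$. -/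

import Mathlib

open Filter Topology MeasureTheory
open scoped ContDiff

/-- The functions `g_m` attached to `Δ : ℝ → ℝ`: `g_0(t) = Δ(t+1)/Δ(t)` and
`g_{m+1}(t) = g_m'(t)/Δ(t)`. They are used only for smooth positive `Δ`, where every `g_m`
is smooth, so that `deriv` is the true derivative and no denominator vanishes. -/
noncomputable def gSeq (Δ : ℝ → ℝ) : ℕ → ℝ → ℝ
  | 0 => fun t => Δ (t + 1) / Δ t
  | m + 1 => fun t => deriv (gSeq Δ m) t / Δ t

/-! Take Δ = `density T`, a sum over k in ℤ^(ℕ) of Poisson kernels centred at Σ k_i T_i, of width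
e^h and mass π e^{-√h}, where h = `height k`. The symmetry k ↦ -k gives evenness, and Σ e^{-√h} < ∞
gives integrability. Translation by T_i permutes the kernels and alters h by at most 16^(i+1), so it
costs a factor independent of T (`density_add_le`); the τ_i are then taken so large that u(τ_i)
exceeds this factor.

Let r = `scale T t`, which tends to ∞ with |t|. On the complex disc of radius r/16 about t the sum
is holomorphic and within Δ(t)/2 of Δ(t), so Cauchy estimates bound |g_m - lim g_m| by C/(r (rΔ)^m)
(`exists_gSeqC_bound`). Because T_0 = 0, each centre carries arbitrarily wide kernels, whence rΔ ≥ c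
e^{-√(log 2r + 16)} (`exp_le_scale_mul_density`). This loss is smaller than any power of r, so the
bound tends to 0. -/

/-! ### Heights on the index group and summability of the masses. -/

/-- A weighted `ℓ¹`-norm on the free abelian group `ℤ^(ℕ)`. -/
noncomputable def height (k : ℕ →₀ ℤ) : ℝ := k.sum fun i n => (16 : ℝ) ^ (i + 1) * |(n : ℝ)|

theorem height_eq_sum_of_subset {k : ℕ →₀ ℤ} {s : Finset ℕ} (h : k.support ⊆ s) :
    height k = ∑ i ∈ s, (16 : ℝ) ^ (i + 1) * |(k i : ℝ)| :=
  Finsupp.sum_of_support_subset _ h _ (by simp)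

theorem height_nonneg (k : ℕ →₀ ℤ) : 0 ≤ height k :=
  Finset.sum_nonneg fun _ _ => by positivity

theorem height_neg (k : ℕ →₀ ℤ) : height (-k) = height k := by
  rw [height_eq_sum_of_subset (k := -k) (s := k.support) (by simp),
    height_eq_sum_of_subset (Finset.Subset.refl k.support)]
  simp

theorem height_add_le (k l : ℕ →₀ ℤ) : height (k + l) ≤ height k + height l := by
  rw [height_eq_sum_of_subset (k := k + l) (s := k.support ∪ l.support) Finsupp.support_add,
    height_eq_sum_of_subset (k := k) Finset.subset_union_left,
    height_eq_sum_of_subset (k := l) (Finset.subset_union_right (s₁ := k.support)),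
    ← Finset.sum_add_distrib]
  refine Finset.sum_le_sum fun i _ => ?_
  rw [← mul_add]
  gcongr
  simpa using abs_add_le (k i : ℝ) (l i)

theorem height_single (i : ℕ) (n : ℤ) :
    height (Finsupp.single i n) = (16 : ℝ) ^ (i + 1) * |(n : ℝ)| :=
  Finsupp.sum_single_index (by simp)

theorem le_height (k : ℕ →₀ ℤ) (i : ℕ) : (16 : ℝ) ^ (i + 1) * |(k i : ℝ)| ≤ height k := by
  by_cases h : i ∈ k.support
  · exact Finset.single_le_sum (f := fun i => (16 : ℝ) ^ (i + 1) * |(k i : ℝ)|)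
      (fun _ _ => by positivity) h
  · rw [Finsupp.notMem_support_iff.mp h]
    simpa using height_nonneg k

/-- Each coordinate gives 4^(i+1) √|k_i| ≤ √h; the spare factors 2^{-(i+1)} sum to at most 1. This
splits e^{-√h} into a product over coordinates. -/
theorem sum_two_pow_mul_sqrt_le (k : ℕ →₀ ℤ) (N : ℕ) :
    ∑ i ∈ Finset.range N, (2 : ℝ) ^ (i + 1) * √|(k i : ℝ)| ≤ √(height k) := by
  have h1 : ∀ i ∈ Finset.range N,
      (2 : ℝ) ^ (i + 1) * √|(k i : ℝ)| ≤ (1 / 2) ^ (i + 1) * √(height k) := fun i _ => by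
    have h2 := Real.sqrt_le_sqrt (le_height k i)
    rw [Real.sqrt_mul (by positivity), show (16 : ℝ) = 4 ^ 2 by norm_num, ← pow_mul, mul_comm 2,
      pow_mul, Real.sqrt_sq (by positivity)] at h2
    calc (2 : ℝ) ^ (i + 1) * √|(k i : ℝ)|
        = (1 / 2) ^ (i + 1) * (4 ^ (i + 1) * √|(k i : ℝ)|) := by
          rw [← mul_assoc, ← mul_pow]; norm_num
      _ ≤ _ := by gcongr
  have h3 : ∑ i ∈ Finset.range N, (1 / 2 : ℝ) ^ (i + 1) ≤ 1 := by
    have := sum_geometric_two_le N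
    simp only [pow_succ, ← Finset.sum_mul]
    linarith
  calc _ ≤ ∑ i ∈ Finset.range N, (1 / 2 : ℝ) ^ (i + 1) * √(height k) := Finset.sum_le_sum h1
    _ = (∑ i ∈ Finset.range N, (1 / 2 : ℝ) ^ (i + 1)) * √(height k) := by rw [Finset.sum_mul]
    _ ≤ 1 * √(height k) := by gcongr
    _ = _ := one_mul _

theorem exp_neg_two_pow_mul_sqrt_le (i : ℕ) (n : ℤ) :
    Real.exp (-((2 : ℝ) ^ (i + 1) * √|(n : ℝ)|)) ≤
      (if n = 0 then 1 else 0) + 24 / 16 ^ (i + 1) * (1 / (n : ℝ) ^ 2) := by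
  split_ifs with h
  · simp [h]
  · have hn : 0 < |(n : ℝ)| := by positivity
    -- The fourth power turns √|n| into the summable weight n^{-2}.
    have h1 := Real.pow_div_factorial_le_exp ((2 : ℝ) ^ (i + 1) * √|(n : ℝ)|) (by positivity) 4
    have h2 : ((2 : ℝ) ^ (i + 1) * √|(n : ℝ)|) ^ 4 = 16 ^ (i + 1) * (n : ℝ) ^ 2 := by
      rw [mul_pow, ← pow_mul, mul_comm (i + 1), pow_mul, show √|(n : ℝ)| ^ 4 = (√|(n : ℝ)| ^ 2) ^ 2
        by ring, Real.sq_sqrt hn.le, sq_abs]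
      norm_num
    rw [h2] at h1
    have hn2 : 0 < (n : ℝ) ^ 2 := by positivity
    rw [Real.exp_neg, zero_add]
    refine (inv_anti₀ (by positivity) h1).trans_eq ?_
    norm_num [Nat.factorial]
    field_simp

/-- Finite partial sums are dominated by a product of one-coordinate sums, each 1 + O(2^{-i}), so
the product stays bounded. -/
theorem summable_exp_neg_sqrt_height :
    Summable fun k : ℕ →₀ ℤ => Real.exp (-√(height k)) := by
  classical
  set c : ℝ := ∑' n : ℤ, 1 / (n : ℝ) ^ 2 with hc
  have hsum : Summable fun n : ℤ => 1 / (n : ℝ) ^ 2 := Real.summable_one_div_int_pow.mpr one_lt_two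
  have hc0 : 0 ≤ c := tsum_nonneg fun _ => by positivity
  let f : ℕ → ℤ → ℝ := fun i n => (if n = 0 then 1 else 0) + 24 / 16 ^ (i + 1) * (1 / (n : ℝ) ^ 2)
  have hf0 : ∀ i n, 0 ≤ f i n := fun i n => (Real.exp_pos _).le.trans
    (exp_neg_two_pow_mul_sqrt_le i n)
  have hfs : ∀ i (s : Finset ℤ), ∑ n ∈ s, f i n ≤ Real.exp (24 * c * (1 / 2) ^ (i + 1)) := by
    intro i s
    have h1 : ∑ n ∈ s, (if n = 0 then (1 : ℝ) else 0) ≤ 1 := by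
      rw [Finset.sum_ite_eq']; split_ifs <;> norm_num
    have h2 : ∑ n ∈ s, 1 / (n : ℝ) ^ 2 ≤ c := hsum.sum_le_tsum s fun _ _ => by positivity
    have h3 : (24 : ℝ) / 16 ^ (i + 1) ≤ 24 * (1 / 2) ^ (i + 1) := by
      rw [div_eq_mul_inv, ← inv_pow]; gcongr; norm_num
    calc ∑ n ∈ s, f i n = ∑ n ∈ s, (if n = 0 then (1 : ℝ) else 0)
          + 24 / 16 ^ (i + 1) * ∑ n ∈ s, 1 / (n : ℝ) ^ 2 := by
          rw [Finset.mul_sum, ← Finset.sum_add_distrib]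
      _ ≤ 1 + 24 * (1 / 2) ^ (i + 1) * c := by gcongr
      _ ≤ Real.exp (24 * c * (1 / 2) ^ (i + 1)) := by
          have := Real.add_one_le_exp (24 * c * (1 / 2) ^ (i + 1)); linarith
  refine summable_of_sum_le (c := Real.exp (24 * c)) (fun _ => (Real.exp_pos _).le) fun S => ?_
  obtain ⟨N, hN⟩ : ∃ N, ∀ k ∈ S, k.support ⊆ Finset.range N := by
    refine ⟨(S.sup Finsupp.support).sup id + 1, fun k hk i hi => ?_⟩
    rw [Finset.mem_range, Nat.lt_succ_iff]
    exact Finset.le_sup (f := id) (Finset.le_sup (f := Finsupp.support) hk hi)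
  let φ : (ℕ →₀ ℤ) → Fin N → ℤ := fun k i => k i
  let t : Fin N → Finset ℤ := fun i => S.image fun k => k i
  have hφ : Set.InjOn φ S := fun k hk l hl h => by
    ext i
    by_cases hi : i < N
    · exact congrFun h ⟨i, hi⟩
    · rw [Finsupp.notMem_support_iff.mp fun h' => hi (Finset.mem_range.mp (hN k hk h')),
        Finsupp.notMem_support_iff.mp fun h' => hi (Finset.mem_range.mp (hN l hl h'))]
  have hle : ∀ k, Real.exp (-√(height k)) ≤ ∏ i : Fin N, f i (φ k i) := fun k => by
    calc Real.exp (-√(height k))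
        ≤ Real.exp (∑ i ∈ Finset.range N, -((2 : ℝ) ^ (i + 1) * √|(k i : ℝ)|)) := by
          rw [Finset.sum_neg_distrib]
          exact Real.exp_le_exp.mpr (neg_le_neg (sum_two_pow_mul_sqrt_le k N))
      _ = ∏ i : Fin N, Real.exp (-((2 : ℝ) ^ ((i : ℕ) + 1) * √|(k i : ℝ)|)) := by
          rw [Real.exp_sum, Finset.prod_range]
      _ ≤ _ := Finset.prod_le_prod (fun _ _ => (Real.exp_pos _).le)
          fun i _ => exp_neg_two_pow_mul_sqrt_le i (k i)
  calc ∑ k ∈ S, Real.exp (-√(height k)) ≤ ∑ k ∈ S, ∏ i : Fin N, f i (φ k i) :=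
        Finset.sum_le_sum fun k _ => hle k
    _ = ∑ p ∈ S.image φ, ∏ i : Fin N, f i (p i) := by
        rw [Finset.sum_image hφ]
    _ ≤ ∑ p ∈ Fintype.piFinset t, ∏ i : Fin N, f i (p i) := by
        refine Finset.sum_le_sum_of_subset_of_nonneg (fun p hp => ?_)
          fun _ _ _ => Finset.prod_nonneg fun _ _ => hf0 _ _
        obtain ⟨k, hk, rfl⟩ := Finset.mem_image.mp hp
        exact Fintype.mem_piFinset.mpr fun i => Finset.mem_image_of_mem _ hk
    _ = ∏ i : Fin N, ∑ n ∈ t i, f i n := (Finset.prod_univ_sum t fun i n => f i n).symm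
    _ ≤ ∏ i : Fin N, Real.exp (24 * c * (1 / 2) ^ ((i : ℕ) + 1)) :=
        Finset.prod_le_prod (fun _ _ => Finset.sum_nonneg fun _ _ => hf0 _ _) fun i _ => hfs i _
    _ = Real.exp (24 * c * ∑ i ∈ Finset.range N, (1 / 2 : ℝ) ^ (i + 1)) := by
        rw [← Real.exp_sum, Finset.mul_sum, Finset.sum_range]
    _ ≤ Real.exp (24 * c) := by
        have := sum_geometric_two_le N
        refine Real.exp_le_exp.mpr (mul_le_of_le_one_right (by positivity) ?_)
        simp only [pow_succ, ← Finset.sum_mul]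
        linarith

theorem finite_height_le (L : ℝ) : {k : ℕ →₀ ℤ | height k ≤ L}.Finite := by
  have h := summable_exp_neg_sqrt_height.tendsto_cofinite_zero.eventually_lt_const
    (Real.exp_pos (-√L))
  refine (Filter.eventually_cofinite.mp h).subset fun k hk => ?_
  simpa using Real.sqrt_le_sqrt hk

/-- Moving along the zeroth generator adjusts the height up to a bounded error. -/
theorem exists_height_add_single_mem_Icc {k : ℕ →₀ ℤ} {s : ℝ} (h : height k ≤ s) :
    ∃ j : ℤ, height (k + Finsupp.single 0 j) ∈ Set.Icc s (s + 16) := by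
  classical
  have hex : ∃ j : ℕ, s ≤ height (k + Finsupp.single 0 (j : ℤ)) := by
    obtain ⟨j, hj⟩ := exists_nat_ge (|s| + |(k 0 : ℝ)|)
    refine ⟨j, ?_⟩
    have h1 := le_height (k + Finsupp.single 0 (j : ℤ)) 0
    simp only [Finsupp.add_apply, Finsupp.single_eq_same] at h1
    push_cast at h1
    have h2 := le_abs_self ((k 0 : ℝ) + j)
    have h3 := neg_abs_le (k 0 : ℝ)
    have h4 := le_abs_self s
    have h5 := abs_nonneg s
    nlinarith
  have hj := Nat.find_spec hex
  -- At the least such j, either j = 0 and the height is s itself, or the previous height was below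
  -- s and one step adds at most 16.
  rcases hj0 : Nat.find hex with _ | n
  · rw [hj0] at hj
    refine ⟨0, by simpa using hj, ?_⟩
    simp only [Finsupp.single_zero, add_zero]
    linarith
  · rw [hj0] at hj
    refine ⟨_, hj, ?_⟩
    have hn := Nat.find_min hex (m := n) (by omega)
    have h1 := height_add_le (k + Finsupp.single 0 (n : ℤ)) (Finsupp.single 0 1)
    have h2 : Finsupp.single (M := ℤ) 0 ((n + 1 : ℕ) : ℤ)
        = Finsupp.single 0 (n : ℤ) + Finsupp.single 0 1 := by
      rw [← Finsupp.single_add]; push_cast; rfl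
    rw [height_single] at h1
    norm_num at h1
    rw [h2, ← add_assoc]
    linarith [not_le.mp hn]

/-! ### The kernels, their complex extensions and their scales. -/

/-- The homomorphism `ℤ^(ℕ) → ℝ` sending the `i`-th generator to `T i`. -/
noncomputable def center (T : ℕ → ℝ) : (ℕ →₀ ℤ) →ₗ[ℤ] ℝ := Finsupp.linearCombination ℤ T

theorem center_single (T : ℕ → ℝ) (i : ℕ) (n : ℤ) :
    center T (Finsupp.single i n) = n * T i := by
  simp [center, Finsupp.linearCombination_single]

/-- The Poisson kernel of width `exp (height k)` centred at `center T k`, of mass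
`π * exp (-√(height k))`. -/
noncomputable def bump (T : ℕ → ℝ) (k : ℕ →₀ ℤ) (t : ℝ) : ℝ :=
  Real.exp (-√(height k)) * Real.exp (height k) /
    (Real.exp (height k) ^ 2 + (t - center T k) ^ 2)

/-- The complex extension of `bump`. -/
noncomputable def bumpC (T : ℕ → ℝ) (k : ℕ →₀ ℤ) (z : ℂ) : ℂ :=
  (Real.exp (-√(height k)) * Real.exp (height k) : ℝ) /
    ((Real.exp (height k) : ℂ) ^ 2 + (z - center T k) ^ 2)

theorem bumpC_ofReal (T : ℕ → ℝ) (k : ℕ →₀ ℤ) (t : ℝ) : bumpC T k t = bump T k t := by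
  simp [bumpC, bump]

theorem bump_pos (T : ℕ → ℝ) (k : ℕ →₀ ℤ) (t : ℝ) : 0 < bump T k t := by
  unfold bump; positivity

theorem one_le_exp_height (k : ℕ →₀ ℤ) : 1 ≤ Real.exp (height k) :=
  Real.one_le_exp (height_nonneg k)

theorem bump_le (T : ℕ → ℝ) (k : ℕ →₀ ℤ) (t : ℝ) : bump T k t ≤ Real.exp (-√(height k)) := by
  unfold bump
  have h := one_le_exp_height k
  rw [div_le_iff₀ (by positivity)]
  gcongr
  nlinarith [sq_nonneg (t - center T k)]

theorem summable_bump (T : ℕ → ℝ) (t : ℝ) : Summable fun k => bump T k t :=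
  summable_exp_neg_sqrt_height.of_nonneg_of_le (fun k => (bump_pos T k t).le)
    fun k => bump_le T k t

/-- The distance scale of the `k`-th kernel at `t`. -/
noncomputable def bumpScale (T : ℕ → ℝ) (t : ℝ) (k : ℕ →₀ ℤ) : ℝ :=
  Real.exp (height k) + |t - center T k|

/-- The smallest scale of a kernel at `t`. -/
noncomputable def scale (T : ℕ → ℝ) (t : ℝ) : ℝ := ⨅ k, bumpScale T t k

theorem one_le_bumpScale (T : ℕ → ℝ) (t : ℝ) (k : ℕ →₀ ℤ) : 1 ≤ bumpScale T t k :=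
  (one_le_exp_height k).trans (le_add_of_nonneg_right (abs_nonneg _))

theorem one_le_scale (T : ℕ → ℝ) (t : ℝ) : 1 ≤ scale T t := le_ciInf (one_le_bumpScale T t)

theorem scale_le (T : ℕ → ℝ) (t : ℝ) (k : ℕ →₀ ℤ) : scale T t ≤ bumpScale T t k :=
  ciInf_le ⟨1, Set.forall_mem_range.mpr (one_le_bumpScale T t)⟩ k

/-- Only finitely many kernels have height at most R, and their centres are bounded; all others have
width above R. -/
theorem tendsto_scale (T : ℕ → ℝ) : Tendsto (scale T) (cocompact ℝ) atTop := by
  refine tendsto_atTop.mpr fun R => ?_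
  obtain ⟨B, hB⟩ := ((finite_height_le R).image fun k => |center T k|).bddAbove
  filter_upwards [tendsto_norm_cocompact_atTop.eventually_ge_atTop (R + B)] with t ht
  refine le_ciInf fun k => ?_
  rw [Real.norm_eq_abs] at ht
  unfold bumpScale
  by_cases hk : height k ≤ R
  · have h1 : |center T k| ≤ B := hB ⟨k, hk, rfl⟩
    have h2 := abs_sub_abs_le_abs_sub t (center T k)
    linarith [Real.exp_pos (height k)]
  · have h1 := Real.add_one_le_exp (height k)
    linarith [abs_nonneg (t - center T k)]

/-- The poles lie at distance comparable to `bumpScale` from t, so a disc of a small fraction of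
that radius avoids them. -/
theorem bumpC_denom_estimate {T : ℕ → ℝ} {t : ℝ} {z : ℂ} (h : ‖z - t‖ ≤ scale T t / 16)
    (k : ℕ →₀ ℤ) :
    ‖((Real.exp (height k) : ℂ) ^ 2 + (z - center T k) ^ 2)
        - (Real.exp (height k) ^ 2 + (t - center T k) ^ 2 : ℝ)‖
      ≤ (Real.exp (height k) ^ 2 + (t - center T k) ^ 2) / 3 := by
  have h1 : ‖z - t‖ ≤ bumpScale T t k / 16 := h.trans (by linarith [scale_le T t k])
  unfold bumpScale at h1
  set w := Real.exp (height k)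
  have hw : 0 < w := Real.exp_pos _
  set x := t - center T k with hx
  have e : ((w : ℂ) ^ 2 + (z - center T k) ^ 2) - (w ^ 2 + x ^ 2 : ℝ)
      = 2 * (x : ℂ) * (z - t) + (z - t) ^ 2 := by
    rw [hx]; push_cast; ring
  rw [e]
  have h2 : ‖2 * (x : ℂ) * (z - t) + (z - t) ^ 2‖ ≤ 2 * |x| * ‖z - t‖ + ‖z - t‖ ^ 2 := by
    refine (norm_add_le _ _).trans_eq ?_
    simp
  have hn := norm_nonneg (z - (t : ℂ))
  have hx0 := abs_nonneg x
  rw [← sq_abs x]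
  set y := |x|
  nlinarith [mul_le_mul_of_nonneg_left h1 hx0, mul_le_mul h1 h1 hn (by positivity),
    sq_nonneg (w - y)]

theorem bumpC_denom_ne_zero {T : ℕ → ℝ} {t : ℝ} {z : ℂ} (h : ‖z - t‖ ≤ scale T t / 16)
    (k : ℕ →₀ ℤ) : (Real.exp (height k) : ℂ) ^ 2 + (z - center T k) ^ 2 ≠ 0 := by
  intro h0
  have h1 := bumpC_denom_estimate h k
  have hA : 0 < Real.exp (height k) ^ 2 + (t - center T k) ^ 2 := by positivity
  rw [h0, zero_sub, norm_neg, Complex.norm_real, Real.norm_eq_abs, abs_of_pos hA] at h1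
  linarith

/-- On the disc of radius `scale T t / 16` around `t` each kernel is nearly constant. -/
theorem norm_bumpC_sub_le {T : ℕ → ℝ} {t : ℝ} {z : ℂ} (h : ‖z - t‖ ≤ scale T t / 16)
    (k : ℕ →₀ ℤ) : ‖bumpC T k z - bump T k t‖ ≤ bump T k t / 2 := by
  have h1 := bumpC_denom_estimate h k
  have hB := bumpC_denom_ne_zero h k
  rw [← bumpC_ofReal]
  have e : bump T k t = Real.exp (-√(height k)) * Real.exp (height k) /
    (Real.exp (height k) ^ 2 + (t - center T k) ^ 2) := rfl
  rw [e]
  unfold bumpC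
  set B := (Real.exp (height k) : ℂ) ^ 2 + (z - center T k) ^ 2
  set c := Real.exp (-√(height k)) * Real.exp (height k)
  have hc : 0 < c := by positivity
  set A := Real.exp (height k) ^ 2 + (t - center T k) ^ 2 with hAdef
  have hA : 0 < A := by positivity
  have hA' : (Real.exp (height k) : ℂ) ^ 2 + ((t : ℂ) - center T k) ^ 2 = (A : ℂ) := by
    rw [hAdef]; push_cast; ring
  rw [hA']
  have hA0 : (A : ℂ) ≠ 0 := by exact_mod_cast hA.ne'
  have hBn : 2 / 3 * A ≤ ‖B‖ := by
    have h2 := norm_sub_norm_le (A : ℂ) B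
    rw [norm_sub_rev, Complex.norm_real, Real.norm_eq_abs, abs_of_pos hA] at h2
    linarith
  rw [div_sub_div _ _ hB hA0, show (c : ℂ) * A - B * c = c * (A - B) by ring, norm_div, norm_mul,
    norm_mul, norm_sub_rev, Complex.norm_real, Complex.norm_real, Real.norm_eq_abs,
    Real.norm_eq_abs, abs_of_pos hA, abs_of_pos hc, div_div,
    div_le_div_iff₀ (mul_pos (by linarith) hA) (by positivity)]
  calc c * ‖B - A‖ * (A * 2) ≤ c * (A / 3) * (A * 2) := by gcongr
    _ = c * ((2 / 3 * A) * A) := by ring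
    _ ≤ c * (‖B‖ * A) := by gcongr

theorem integrable_bump (T : ℕ → ℝ) (k : ℕ →₀ ℤ) : Integrable (bump T k) := by
  have hw := Real.exp_pos (height k)
  have h := ((integrable_inv_one_add_sq.comp_div hw.ne').comp_sub_right (center T k)).const_mul
    (Real.exp (-√(height k)) / Real.exp (height k))
  refine h.congr (.of_forall fun t => ?_)
  simp only [bump]
  field_simp

theorem integral_bump (T : ℕ → ℝ) (k : ℕ →₀ ℤ) :
    ∫ t, bump T k t = Real.pi * Real.exp (-√(height k)) := by
  have hw := Real.exp_pos (height k)
  have h : ∀ t, bump T k t = Real.exp (-√(height k)) / Real.exp (height k) *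
      (fun x => (1 + (x / Real.exp (height k)) ^ 2)⁻¹) (t - center T k) := fun t => by
    simp only [bump]
    field_simp
  simp_rw [h]
  rw [integral_const_mul, integral_sub_right_eq_self
    (fun x => (1 + (x / Real.exp (height k)) ^ 2)⁻¹),
    Measure.integral_comp_div (fun x : ℝ => (1 + x ^ 2)⁻¹), integral_univ_inv_one_add_sq,
    abs_of_pos hw, smul_eq_mul]
  field_simp

theorem bump_neg (T : ℕ → ℝ) (k : ℕ →₀ ℤ) (t : ℝ) : bump T (-k) (-t) = bump T k t := by
  simp only [bump, height_neg, map_neg]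
  congr 2
  ring

/-- Translating by a generator costs a factor depending only on that generator. -/
theorem bump_add_single_le (T : ℕ → ℝ) (k : ℕ →₀ ℤ) (i : ℕ) (t : ℝ) :
    bump T (k + Finsupp.single i 1) (t + T i) ≤ Real.exp (4 * 16 ^ (i + 1)) * bump T k t := by
  have h1 : height (k + Finsupp.single i 1) ≤ height k + 16 ^ (i + 1) := by
    simpa [height_single] using height_add_le k (Finsupp.single i 1)
  have h2 : height k ≤ height (k + Finsupp.single i 1) + 16 ^ (i + 1) := by
    have := height_add_le (k + Finsupp.single i 1) (Finsupp.single i (-1))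
    rwa [add_assoc, ← Finsupp.single_add, height_single, add_neg_cancel, Finsupp.single_zero,
      add_zero, show |((-1 : ℤ) : ℝ)| = 1 by norm_num, mul_one] at this
  have hl : (1 : ℝ) ≤ 16 ^ (i + 1) := one_le_pow₀ (by norm_num)
  set l : ℝ := 16 ^ (i + 1)
  have h0 := height_nonneg k
  have h0' := height_nonneg (k + Finsupp.single i 1)
  -- Squaring suffices, since l ≤ l² for l ≥ 1.
  have hs : √(height k) ≤ √(height (k + Finsupp.single i 1)) + l := by
    refine (Real.sqrt_le_left (by positivity)).mpr ?_
    nlinarith [Real.sq_sqrt h0', Real.sqrt_nonneg (height (k + Finsupp.single i 1))]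
  have hx : t + T i - center T (k + Finsupp.single i 1) = t - center T k := by
    rw [map_add, center_single]; push_cast; ring
  unfold bump
  rw [hx]
  set a := height k
  set b := height (k + Finsupp.single i 1)
  set x := t - center T k
  have e1 : Real.exp (-√b) ≤ Real.exp l * Real.exp (-√a) := by
    rw [← Real.exp_add]; exact Real.exp_le_exp.mpr (by linarith)
  have e2 : Real.exp b ≤ Real.exp l * Real.exp a := by
    rw [← Real.exp_add]; exact Real.exp_le_exp.mpr (by linarith)
  have e3 : Real.exp a ≤ Real.exp l * Real.exp b := by
    rw [← Real.exp_add]; exact Real.exp_le_exp.mpr (by linarith)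
  have hV : 1 ≤ Real.exp l := Real.one_le_exp (by linarith)
  have e4 : Real.exp (4 * l) = Real.exp l ^ 4 := by
    rw [← Real.exp_nat_mul]; norm_num
  have e5 : Real.exp a ^ 2 + x ^ 2 ≤ Real.exp l ^ 2 * (Real.exp b ^ 2 + x ^ 2) := by
    have := pow_le_pow_left₀ (Real.exp_pos a).le e3 2
    nlinarith [sq_nonneg x, one_le_pow₀ hV (n := 2)]
  rw [e4, ← mul_div_assoc, div_le_div_iff₀ (by positivity) (by positivity)]
  -- Of the four factors e^l, one comes from the mass, one from the width and two from the
  -- denominator.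
  calc Real.exp (-√b) * Real.exp b * (Real.exp a ^ 2 + x ^ 2)
      ≤ (Real.exp l * Real.exp (-√a)) * (Real.exp l * Real.exp a) *
        (Real.exp l ^ 2 * (Real.exp b ^ 2 + x ^ 2)) := by gcongr
    _ = _ := by ring

/-! ### The density: symmetry, translation, smoothness, integrability. -/

/-- The superposition of all the kernels `bump T k`. -/
noncomputable def density (T : ℕ → ℝ) (t : ℝ) : ℝ := ∑' k, bump T k t

/-- The complex extension of `density`. -/
noncomputable def densityC (T : ℕ → ℝ) (z : ℂ) : ℂ := ∑' k, bumpC T k z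

theorem densityC_ofReal (T : ℕ → ℝ) (t : ℝ) : densityC T t = density T t := by
  simp only [densityC, density, bumpC_ofReal, Complex.ofReal_tsum]

theorem bump_le_density (T : ℕ → ℝ) (k : ℕ →₀ ℤ) (t : ℝ) : bump T k t ≤ density T t :=
  (summable_bump T t).le_tsum k fun j _ => (bump_pos T j t).le

theorem density_pos (T : ℕ → ℝ) (t : ℝ) : 0 < density T t :=
  (bump_pos T 0 t).trans_le (bump_le_density T 0 t)

theorem density_neg (T : ℕ → ℝ) (t : ℝ) : density T (-t) = density T t := by
  unfold density
  rw [← (Equiv.neg (ℕ →₀ ℤ)).tsum_eq]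
  exact tsum_congr fun k => bump_neg T k t

theorem density_add_le (T : ℕ → ℝ) (i : ℕ) (t : ℝ) :
    density T (t + T i) ≤ Real.exp (4 * 16 ^ (i + 1)) * density T t := by
  let e : (ℕ →₀ ℤ) ≃ (ℕ →₀ ℤ) := Equiv.addRight (Finsupp.single i 1)
  have hs : Summable fun k => bump T (e k) (t + T i) :=
    (e.summable_iff (f := fun k => bump T k (t + T i))).mpr (summable_bump T _)
  calc density T (t + T i) = ∑' k, bump T (e k) (t + T i) :=
        (e.tsum_eq fun k => bump T k (t + T i)).symm
    _ ≤ ∑' k, Real.exp (4 * 16 ^ (i + 1)) * bump T k t :=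
        hs.tsum_le_tsum (fun k => bump_add_single_le T k i t) ((summable_bump T t).mul_left _)
    _ = _ := tsum_mul_left

theorem norm_bumpC_le {T : ℕ → ℝ} {t : ℝ} {z : ℂ} (h : ‖z - t‖ ≤ scale T t / 16)
    (k : ℕ →₀ ℤ) : ‖bumpC T k z‖ ≤ 3 / 2 * bump T k t := by
  have h1 := norm_bumpC_sub_le h k
  have h2 := norm_sub_norm_le (bumpC T k z) (bump T k t)
  rw [Complex.norm_real, Real.norm_eq_abs, abs_of_pos (bump_pos T k t)] at h2
  linarith

theorem norm_densityC_sub_le {T : ℕ → ℝ} {t : ℝ} {z : ℂ} (h : ‖z - t‖ ≤ scale T t / 16) :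
    ‖densityC T z - density T t‖ ≤ density T t / 2 := by
  have hs : Summable fun k => bumpC T k z :=
    .of_norm_bounded ((summable_bump T t).mul_left _) (norm_bumpC_le h)
  have hs' : Summable fun k => (bump T k t : ℂ) := Complex.ofRealCLM.summable (summable_bump T t)
  rw [densityC, density, Complex.ofReal_tsum, ← hs.tsum_sub hs', ← tsum_div_const]
  exact tsum_of_norm_bounded ((summable_bump T t).div_const 2).hasSum (norm_bumpC_sub_le h)

theorem density_div_two_le_norm {T : ℕ → ℝ} {t : ℝ} {z : ℂ} (h : ‖z - t‖ ≤ scale T t / 16) :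
    density T t / 2 ≤ ‖densityC T z‖ := by
  have h1 := norm_densityC_sub_le h
  have h2 := norm_sub_norm_le (density T t : ℂ) (densityC T z)
  rw [norm_sub_rev, Complex.norm_real, Real.norm_eq_abs, abs_of_pos (density_pos T t)] at h2
  linarith

theorem densityC_ne_zero {T : ℕ → ℝ} {t : ℝ} {z : ℂ} (h : ‖z - t‖ ≤ scale T t / 16) :
    densityC T z ≠ 0 :=
  norm_pos_iff.mp (lt_of_lt_of_le (half_pos (density_pos T t)) (density_div_two_le_norm h))

theorem norm_sub_le_of_mem_ball {T : ℕ → ℝ} {t : ℝ} {z : ℂ}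
    (h : z ∈ Metric.ball (t : ℂ) (scale T t / 16)) : ‖z - t‖ ≤ scale T t / 16 :=
  (mem_ball_iff_norm.mp h).le

theorem differentiableOn_densityC (T : ℕ → ℝ) (t : ℝ) :
    DifferentiableOn ℂ (densityC T) (Metric.ball (t : ℂ) (scale T t / 16)) := by
  refine Complex.differentiableOn_tsum_of_summable_norm ((summable_bump T t).mul_left (3 / 2))
    (fun k => ?_) Metric.isOpen_ball fun k z hz => norm_bumpC_le (norm_sub_le_of_mem_ball hz) k
  unfold bumpC
  refine DifferentiableOn.div (by fun_prop) (by fun_prop) fun z hz => ?_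
  exact bumpC_denom_ne_zero (norm_sub_le_of_mem_ball hz) k

theorem analyticAt_densityC (T : ℕ → ℝ) (t : ℝ) : AnalyticAt ℂ (densityC T) t :=
  (differentiableOn_densityC T t).analyticAt
    (Metric.ball_mem_nhds _ (by linarith [one_le_scale T t]))

theorem contDiff_density (T : ℕ → ℝ) : ContDiff ℝ ∞ (density T) := by
  have h : density T = fun t : ℝ => (densityC T t).re := by
    ext t; rw [densityC_ofReal, Complex.ofReal_re]
  rw [h, contDiff_iff_contDiffAt]
  intro t
  exact (analyticAt_densityC T t).contDiffAt.real_of_complex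

theorem integrable_density (T : ℕ → ℝ) : Integrable (density T) := by
  refine ⟨(contDiff_density T).continuous.aestronglyMeasurable, ?_⟩
  have h1 : ∀ t, ‖density T t‖ₑ = ∑' k, ENNReal.ofReal (bump T k t) := fun t => by
    rw [Real.enorm_of_nonneg (density_pos T t).le, density,
      ENNReal.ofReal_tsum_of_nonneg (fun k => (bump_pos T k t).le) (summable_bump T t)]
  rw [HasFiniteIntegral]
  simp_rw [h1]
  rw [lintegral_tsum fun k => (integrable_bump T k).aemeasurable.ennreal_ofReal]
  simp_rw [← ofReal_integral_eq_lintegral_ofReal (integrable_bump T _)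
    (.of_forall fun t => (bump_pos T _ t).le), integral_bump]
  exact (summable_exp_neg_sqrt_height.mul_left Real.pi).tsum_ofReal_lt_top

/-! ### Cauchy estimates for the g_m. -/

/-- The complex extension of `gSeq (density T)`. -/
noncomputable def gSeqC (T : ℕ → ℝ) : ℕ → ℂ → ℂ
  | 0 => fun z => densityC T (z + 1) / densityC T z
  | m + 1 => fun z => deriv (gSeqC T m) z / densityC T z

theorem densityC_ofReal_ne_zero (T : ℕ → ℝ) (t : ℝ) : densityC T t ≠ 0 := by
  rw [densityC_ofReal]; exact_mod_cast (density_pos T t).ne'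

theorem analyticAt_gSeqC (T : ℕ → ℝ) (m : ℕ) (t : ℝ) : AnalyticAt ℂ (gSeqC T m) t := by
  induction m with
  | zero =>
    refine AnalyticAt.div ?_ (analyticAt_densityC T t) (densityC_ofReal_ne_zero T t)
    have h : AnalyticAt ℂ (densityC T) ((t : ℂ) + 1) := by
      exact_mod_cast analyticAt_densityC T (t + 1)
    exact h.fun_comp (f := fun z : ℂ => z + 1) (by fun_prop)
  | succ m ih => exact ih.deriv.div (analyticAt_densityC T t) (densityC_ofReal_ne_zero T t)

theorem gSeqC_ofReal (T : ℕ → ℝ) (m : ℕ) (t : ℝ) : gSeqC T m t = gSeq (density T) m t := by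
  induction m generalizing t with
  | zero =>
    simp only [gSeqC, gSeq]
    rw [densityC_ofReal, ← Complex.ofReal_one, ← Complex.ofReal_add, densityC_ofReal,
      Complex.ofReal_div]
  | succ m ih =>
    have h1 : HasDerivAt (gSeqC T m) (deriv (gSeqC T m) t) t :=
      (analyticAt_gSeqC T m t).differentiableAt.hasDerivAt
    have h2 : HasDerivAt (gSeq (density T) m) (deriv (gSeqC T m) t).re t := by
      refine h1.real_of_complex.congr_of_eventuallyEq (.of_forall fun x => ?_)
      simp only [ih, Complex.ofReal_re]
    -- Uniqueness of the derivative along the real line forces the complex derivative to be real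
    -- there.
    have h3 : HasDerivAt (fun x : ℝ => gSeqC T m x) ((deriv (gSeqC T m) t).re : ℂ) t := by
      simp only [ih]
      exact h2.ofReal_comp
    simp only [gSeqC, gSeq]
    rw [h1.comp_ofReal.unique h3, h2.deriv, densityC_ofReal, Complex.ofReal_div]

/-- The limit at infinity of `gSeq (density T) m`. -/
def gLimit (m : ℕ) : ℝ := if m = 0 then 1 else 0

/-- Iterated Cauchy estimates for `gSeqC`. -/
theorem exists_gSeqC_bound (m : ℕ) : ∃ C, 0 < C ∧ ∀ (T : ℕ → ℝ) (t : ℝ), 32 < scale T t →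
    DifferentiableOn ℂ (gSeqC T m) (Metric.ball (t : ℂ) (scale T t / 32 / 2 ^ m)) ∧
    ∀ z ∈ Metric.ball (t : ℂ) (scale T t / 32 / 2 ^ m),
      ‖gSeqC T m z - gLimit m‖ ≤ C / (scale T t * (scale T t * density T t) ^ m) := by
  induction m with
  | zero =>
    refine ⟨128, by norm_num, fun T t ht => ?_⟩
    have hD := density_pos T t
    set r := scale T t with hr
    have hsub : Metric.ball (t : ℂ) (r / 32 / 2 ^ 0) ⊆ Metric.ball (t : ℂ) (r / 16) :=
      Metric.ball_subset_ball (by simp; linarith)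
    have hball : ∀ z ∈ Metric.ball (t : ℂ) (r / 32 / 2 ^ 0),
        Metric.ball z (r / 32) ⊆ Metric.ball (t : ℂ) (r / 16) := fun z hz =>
      Metric.ball_subset_ball' (by rw [Metric.mem_ball] at hz; simp at hz; linarith)
    have hone : ∀ z : ℂ, z + 1 ∈ Metric.ball z (r / 32) := fun z => by
      rw [mem_ball_iff_norm]; simp; linarith
    refine ⟨?_, fun z hz => ?_⟩
    · refine DifferentiableOn.div ?_ ((differentiableOn_densityC T t).mono hsub) fun z hz =>
        densityC_ne_zero (norm_sub_le_of_mem_ball (hsub hz))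
      exact (differentiableOn_densityC T t).comp (f := fun z : ℂ => z + 1) (by fun_prop)
        fun z hz => hball z hz (hone z)
    · have hz0 := densityC_ne_zero (norm_sub_le_of_mem_ball (hsub hz))
      have h1 := density_div_two_le_norm (norm_sub_le_of_mem_ball (hsub hz))
      -- Schwarz lemma on the disc of radius r/32 about z, which contains z + 1 because r > 32.
      have h2 := Complex.dist_le_div_mul_dist_of_mapsTo_ball (R₂ := density T t)
        ((differentiableOn_densityC T t).mono (hball z hz)) (fun y hy => ?_) (hone z)
      · rw [dist_eq_norm, dist_eq_norm, add_sub_cancel_left, norm_one, mul_one] at h2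
        simp only [gSeqC, gLimit, if_true, Complex.ofReal_one]
        rw [div_sub_one hz0, norm_div, pow_zero, mul_one, div_le_div_iff₀ (by linarith)
          (by linarith)]
        calc _ ≤ density T t / (r / 32) * r := by gcongr
          _ = 64 * (density T t / 2) := by field_simp; norm_num
          _ ≤ 128 * ‖densityC T z‖ := by linarith
      · rw [mem_closedBall_iff_norm]
        have h3 := norm_densityC_sub_le (norm_sub_le_of_mem_ball (hball z hz hy))
        have h4 := norm_densityC_sub_le (norm_sub_le_of_mem_ball (hsub hz))
        have h5 := norm_sub_le (densityC T y - density T t) (densityC T z - density T t)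
        rw [sub_sub_sub_cancel_right] at h5
        linarith
  | succ m ih =>
    obtain ⟨C, hC, ih⟩ := ih
    refine ⟨C * 2 * 32 * 2 ^ (m + 1), by positivity, fun T t ht => ?_⟩
    obtain ⟨hd, hb⟩ := ih T t ht
    have hD := density_pos T t
    set r := scale T t with hr
    have hr0 : 0 < r := by linarith
    have hhalf : r / 32 / 2 ^ (m + 1) + r / 32 / 2 ^ (m + 1) = r / 32 / 2 ^ m := by
      rw [pow_succ]; field_simp; norm_num
    have hq : 0 < r / 32 / 2 ^ (m + 1) := by positivity
    have hsub : Metric.ball (t : ℂ) (r / 32 / 2 ^ (m + 1)) ⊆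
        Metric.ball (t : ℂ) (r / 32 / 2 ^ m) := Metric.ball_subset_ball (by linarith)
    have hle : r / 32 / 2 ^ (m + 1) ≤ r / 16 := by
      rw [div_div]
      have : (1 : ℝ) ≤ 2 ^ (m + 1) := one_le_pow₀ (by norm_num)
      exact div_le_div_of_nonneg_left hr0.le (by norm_num) (by linarith)
    have hsub' : Metric.ball (t : ℂ) (r / 32 / 2 ^ (m + 1)) ⊆ Metric.ball (t : ℂ) (r / 16) :=
      Metric.ball_subset_ball hle
    refine ⟨?_, fun z hz => ?_⟩
    · exact ((hd.deriv Metric.isOpen_ball).mono hsub).div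
        ((differentiableOn_densityC T t).mono hsub') fun z hz =>
          densityC_ne_zero (norm_sub_le_of_mem_ball (hsub' hz))
    · have hcl : Metric.closedBall z (r / 32 / 2 ^ (m + 1)) ⊆
          Metric.ball (t : ℂ) (r / 32 / 2 ^ m) := Metric.closedBall_subset_ball' (by
        rw [Metric.mem_ball] at hz; linarith)
      have h1 := density_div_two_le_norm (norm_sub_le_of_mem_ball (hsub' hz))
      -- Subtracting the limit lets Cauchy's estimate act on the error; halving the disc leaves room
      -- for the circle, and dividing by Δ gains 1/(rΔ).
      have h2 := Complex.norm_deriv_le_of_forall_mem_sphere_norm_le hq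
        (f := fun z => gSeqC T m z - gLimit m)
        ((hd.sub_const _).diffContOnCl_ball hcl)
        fun y hy => hb y (hcl (Metric.sphere_subset_closedBall hy))
      rw [deriv_sub_const] at h2
      simp only [gSeqC, gLimit, Nat.succ_ne_zero, if_false, Complex.ofReal_zero, sub_zero]
      rw [norm_div, div_le_div_iff₀ (by linarith) (by positivity)]
      calc _ ≤ C / (r * (r * density T t) ^ m) / (r / 32 / 2 ^ (m + 1)) *
            (r * (r * density T t) ^ (m + 1)) := by gcongr
        _ = C * 2 * 32 * 2 ^ (m + 1) * (density T t / 2) := by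
          rw [pow_succ (r * density T t)]; field_simp
        _ ≤ _ := by gcongr

/-! ### Lower bound for the density and passage to the limit. -/

/-- When the zeroth generator does not move the centres, `density` is almost as large as the
inverse of the scale. -/
theorem exp_le_scale_mul_density {T : ℕ → ℝ} (hT : T 0 = 0) (t : ℝ) :
    Real.exp (-√(Real.log (2 * scale T t) + 16) - 16) / 4 ≤ scale T t * density T t := by
  have hr := one_le_scale T t
  obtain ⟨k, hk⟩ := exists_lt_of_ciInf_lt (show scale T t < 2 * scale T t by linarith)
  set r := scale T t
  unfold bumpScale at hk
  have h1 : height k ≤ Real.log (2 * r) := by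
    rw [Real.le_log_iff_exp_le (by linarith)]
    linarith [abs_nonneg (t - center T k)]
  -- A nearly optimal kernel may be too narrow to contribute at t; the same centre carries one of
  -- width between 2r and 2e^16 r.
  obtain ⟨j, hj1, hj2⟩ := exists_height_add_single_mem_Icc h1
  refine le_trans ?_ (mul_le_mul_of_nonneg_left
    (bump_le_density T (k + Finsupp.single 0 j) t) (by linarith))
  have hc : center T (k + Finsupp.single 0 j) = center T k := by
    rw [map_add, center_single, hT]; simp
  unfold bump
  rw [hc]
  set a := height (k + Finsupp.single 0 j)
  have hW1 : 2 * r ≤ Real.exp a := by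
    rw [← Real.log_le_iff_le_exp (by linarith)]; exact hj1
  have hW2 : Real.exp a ≤ Real.exp 16 * (2 * r) := by
    rw [← Real.exp_log (show 0 < 2 * r by linarith), ← Real.exp_add]
    exact Real.exp_le_exp.mpr (by linarith)
  have hx : (t - center T k) ^ 2 ≤ Real.exp a ^ 2 := by
    rw [← sq_abs]
    have := Real.exp_pos (height k)
    gcongr
    linarith
  have hs : Real.exp (-√(Real.log (2 * r) + 16)) ≤ Real.exp (-√a) :=
    Real.exp_le_exp.mpr (neg_le_neg (Real.sqrt_le_sqrt hj2))
  rw [sub_eq_add_neg, Real.exp_add]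
  set E := Real.exp (-√(Real.log (2 * r) + 16))
  have hW := Real.exp_pos a
  calc E * Real.exp (-16) / 4 ≤ Real.exp (-√a) * Real.exp (-16) / 4 := by gcongr
    _ = Real.exp (-√a) * (r / (2 * (Real.exp 16 * (2 * r)))) := by
      rw [Real.exp_neg 16]; field_simp; norm_num
    _ ≤ Real.exp (-√a) * (r / (2 * Real.exp a)) := by gcongr
    _ = r * (Real.exp (-√a) * Real.exp a / (Real.exp a ^ 2 + Real.exp a ^ 2)) := by
      field_simp; norm_num
    _ ≤ _ := by gcongr

/-- With y = √(log 2r + 16) the expression is a constant times e^{my - y²}. -/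
theorem tendsto_inv_mul_exp_sqrt_log_pow (m : ℕ) : Tendsto
    (fun r : ℝ => (r * (Real.exp (-√(Real.log (2 * r) + 16) - 16) / 4) ^ m)⁻¹) atTop (𝓝 0) := by
  have hy : Tendsto (fun r : ℝ => √(Real.log (2 * r) + 16)) atTop atTop :=
    Real.tendsto_sqrt_atTop.comp (tendsto_atTop_add_const_right _ _
      (Real.tendsto_log_atTop.comp (tendsto_id.const_mul_atTop two_pos)))
  have hp : Tendsto (fun y : ℝ => y * (y + -(m : ℝ))) atTop atTop :=
    tendsto_id.atTop_mul_atTop₀ (tendsto_atTop_add_const_right _ _ tendsto_id)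
  have h := (Real.tendsto_exp_neg_atTop_nhds_zero.comp (hp.comp hy)).const_mul
    (2 * Real.exp 16 * (4 * Real.exp 16) ^ m)
  rw [mul_zero] at h
  refine h.congr' ?_
  filter_upwards [eventually_ge_atTop 1] with r hr
  have hlog : 0 ≤ Real.log (2 * r) := Real.log_nonneg (by linarith)
  simp only [Function.comp_apply]
  set y := √(Real.log (2 * r) + 16) with hydef
  have hy2 : y ^ 2 = Real.log (2 * r) + 16 := Real.sq_sqrt (by linarith)
  have hr2 : r = Real.exp (y ^ 2) / (2 * Real.exp 16) := by
    rw [hy2, Real.exp_add, Real.exp_log (by linarith)]; field_simp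
  rw [show -(y * (y + -(m : ℝ))) = m * y + -y ^ 2 by ring, Real.exp_add, Real.exp_nat_mul, hr2,
    sub_eq_add_neg, Real.exp_add, Real.exp_neg, Real.exp_neg, Real.exp_neg]
  simp only [mul_pow, div_pow, inv_pow]
  field_simp

theorem tendsto_gSeq_density {T : ℕ → ℝ} (hT : T 0 = 0) (m : ℕ) :
    Tendsto (gSeq (density T) m) (cocompact ℝ) (𝓝 (gLimit m)) := by
  obtain ⟨C, hC, hb⟩ := exists_gSeqC_bound m
  have h := ((tendsto_inv_mul_exp_sqrt_log_pow m).comp (tendsto_scale T)).const_mul C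
  rw [mul_zero] at h
  refine tendsto_iff_norm_sub_tendsto_zero.mpr (squeeze_zero' (.of_forall fun _ => norm_nonneg _)
    ?_ h)
  filter_upwards [(tendsto_scale T).eventually_gt_atTop 32] with t ht
  have hr : 0 < scale T t := by linarith
  have h1 := (hb T t ht).2 t (Metric.mem_ball_self (by positivity))
  rw [gSeqC_ofReal, ← Complex.ofReal_sub, Complex.norm_real] at h1
  refine h1.trans ?_
  rw [div_eq_mul_inv]
  have := exp_le_scale_mul_density hT t
  simp only [Function.comp_apply]
  gcongr

theorem theorem3p1 (u : ℕ → ℝ)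
    (hpos : ∀ n : ℕ, 1 ≤ n → 0 < u n)
    (hmono : StrictMonoOn u (Set.Ici 1))
    (hlim : Tendsto u atTop atTop) :
    ∃ Δ : ℝ → ℝ,
      Function.Even Δ ∧ (∀ t, 0 < Δ t) ∧ ContDiff ℝ ∞ Δ ∧
      Integrable Δ volume ∧
      (∃ τ : ℕ → ℕ, StrictMono τ ∧ (∀ i, 0 < τ i) ∧
        ∀ i, BddAbove (Set.range fun t : ℝ => Δ (t + (τ i : ℝ)) / Δ t) ∧
          (⨆ t : ℝ, Δ (t + (τ i : ℝ)) / Δ t) ≤ u (τ i)) ∧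
      (Tendsto (gSeq Δ 0) atTop (𝓝 1) ∧ Tendsto (gSeq Δ 0) atBot (𝓝 1)) ∧
      (∀ m : ℕ, 1 ≤ m →
        Tendsto (gSeq Δ m) atTop (𝓝 0) ∧ Tendsto (gSeq Δ m) atBot (𝓝 0)) := by
  -- Generator 0 is reserved for T_0 = 0, so τ_i belongs to generator i + 1, of weight 16^(i+2).
  obtain ⟨τ, hτ, hτu⟩ := extraction_forall_of_eventually fun i : ℕ =>
    (eventually_gt_atTop 0).and (hlim.eventually_ge_atTop (Real.exp (4 * 16 ^ (i + 2))))
  let T : ℕ → ℝ := fun i => Nat.casesOn i 0 fun i => (τ i : ℝ)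
  have hle : ∀ i t, density T (t + τ i) / density T t ≤ u (τ i) := fun i t => by
    rw [div_le_iff₀ (density_pos T t)]
    exact (density_add_le T (i + 1) t).trans
      (mul_le_mul_of_nonneg_right (hτu i).2 (density_pos T t).le)
  have hlim' := tendsto_gSeq_density (T := T) rfl
  refine ⟨density T, density_neg T, density_pos T, contDiff_density T, integrable_density T,
    ⟨τ, hτ, fun i => (hτu i).1, fun i => ⟨⟨u (τ i), Set.forall_mem_range.mpr (hle i)⟩,
      ciSup_le (hle i)⟩⟩, ?_, fun m hm => ?_⟩
  · have h : Tendsto (gSeq (density T) 0) (cocompact ℝ) (𝓝 1) := hlim' 0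
    exact ⟨h.mono_left atTop_le_cocompact, h.mono_left atBot_le_cocompact⟩
  · have h := hlim' m
    rw [gLimit, if_neg (by omega)] at h
    exact ⟨h.mono_left atTop_le_cocompact, h.mono_left atBot_le_cocompact⟩
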